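/- Let $m,n\ge 0$, let $\mathfrak G_{2n}$ be the real Grassmann algebra on $2n$ anticommuting generators and $\mathfrak G_{2n}^{(ev)}$ its subalgebra of even elements. A superfunction is an element $F$ of $C^\infty(\mathbb R^m)\otimes\mathfrak G_{2n}$; it splits as $F=F_0+\mathbf F$ with body $F_0\in C^\infty(\mathbb R^m)$ (its component along $1$) and nilpotent part $\mathbf F$. A superdistribution is an element of $\mathcal D'(\mathbb R^m)\otimes\mathfrak G_{2n}$, and superfunctions multiply superdistributions by $(a\otimes u)(T\otimes v)=(aT)\otimes(uv)$. For $g_0\in C^\infty(\mathbb R^m)$ whose gradient does not vanish on $g_0^{-1}(0)$, $\delta^{(j)}(g_0)\in\mathcal D'(\mathbb R^m)$ denotes the composition of the $j$-th derivative of the Dirac distribution on $\mathbb R$ with $g_0$, that is, the distribution $$\langle\delta^{(j)}(g_0),f\rangle=\lim_{\varepsilon\to0^+}\int_{\mathbb R^m}\eta_\varepsilon^{(j)}(g_0(x))\,f(x)\,dx,\qquad \eta_\varepsilon(t)=\varepsilon^{-1}\eta(t/\varepsilon),$$ for every $\eta\in C_0^\infty(\mathbb R)$ with $\int\eta=1$.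 For an even superfunction $g=g_0+\mathbf g\in C^\infty(\mathbb R^m)\otimes\mathfrak G_{2n}^{(ev)}$ with such a body, put $$\delta(g)=\sum_{j=0}^{n}\frac{\mathbf g^j}{j!}\,\delta^{(j)}(g_0).$$ Proposition. Let $g=g_0+\mathbf g$ and $h=h_0+\mathbf h$ be elements of $C^\infty(\mathbb R^m)\otimes\mathfrak G_{2n}^{(ev)}$ such that $\partial_{\underline x}[g_0]\ne0$ on $g_0^{-1}(0)$ and $h_0>0$ on $\mathbb R^m$. Then the distributions $\delta^{(j)}(g_0)$ and $\delta^{(j)}(h_0g_0)$, $j\ge0$, exist, $h$ is invertible in $C^\infty(\mathbb R^m)\otimes\mathfrak G_{2n}$, and $$\delta(hg)=\frac{\delta(g)}{h},\qquad\text{that is,}\quad \delta(hg)=h^{-1}\,\delta(g).$$ -/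

import Mathlib

open scoped Distributions ContDiff TensorProduct Topology

noncomputable section

namespace Superspace

/-- The bosonic space `ℝ^m`, with its Euclidean norm and Lebesgue measure. -/
abbrev Bos (m : ℕ) : Type := EuclideanSpace ℝ (Fin m)

/-- The algebra `C^∞(ℝ^m)` of real valued smooth functions, with pointwise operations. -/
def smoothAlg (m : ℕ) : Subalgebra ℝ (Bos m → ℝ) where
  carrier := {f | ContDiff ℝ ∞ f}
  mul_mem' {f g} hf hg := by
    have hf' : ContDiff ℝ ∞ f := hf
    have hg' : ContDiff ℝ ∞ g := hg
    exact hf'.mul hg'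
  add_mem' {f g} hf hg := by
    have hf' : ContDiff ℝ ∞ f := hf
    have hg' : ContDiff ℝ ∞ g := hg
    exact hf'.add hg'
  algebraMap_mem' c := (contDiff_const : ContDiff ℝ ∞ fun _ : Bos m => c)

/-- `C^∞(ℝ^m)`. -/
abbrev Smooth (m : ℕ) : Type := smoothAlg m

/-- The space `𝓓'` of (Schwartz) distributions on `ℝ^m`: the continuous linear functionals on the
space `𝓓 = C^∞_0(ℝ^m)` of test functions. -/
abbrev Dist (m : ℕ) : Type := 𝓓'((⊤ : TopologicalSpace.Opens (Bos m)), ℝ)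

/-- Test functions `C^∞_0(ℝ^m)`. -/
abbrev Test (m : ℕ) : Type := 𝓓((⊤ : TopologicalSpace.Opens (Bos m)), ℝ)

/-! ### Multiplication of a distribution by a smooth function -/

theorem smooth_mul_bound {m : ℕ} (a : Smooth m) (K : TopologicalSpace.Compacts (Bos m)) (i : ℕ) :
    ∃ (s : Finset ℕ) (C : ℝ), 0 ≤ C ∧ ∀ f : 𝓓_{K}(Bos m, ℝ), ∀ x ∈ K,
      ‖iteratedFDeriv ℝ i (fun y => a.1 y * f y) x‖ ≤
        C * (s.sup fun j => ContDiffMapSupportedIn.seminorm ℝ (Bos m) ℝ ⊤ K j) f := by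
  have ha : ContDiff ℝ ∞ a.1 := a.2
  have hb : ∀ k : ℕ, ∃ C : ℝ, 0 ≤ C ∧ ∀ x ∈ K, ‖iteratedFDeriv ℝ k a.1 x‖ ≤ C := by
    intro k
    obtain ⟨C, hC⟩ := K.isCompact.exists_bound_of_continuousOn
      ((ha.continuous_iteratedFDeriv (m := k) (by exact_mod_cast le_top)).continuousOn)
    exact ⟨max C 0, le_max_right _ _, fun x hx => (hC x hx).trans (le_max_left _ _)⟩
  choose B hB0 hB using hb
  refine ⟨Finset.range (i + 1), ∑ k ∈ Finset.range (i + 1), (i.choose k : ℝ) * B k,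
    Finset.sum_nonneg fun k _ => mul_nonneg (Nat.cast_nonneg _) (hB0 k), fun f x hx => ?_⟩
  refine (norm_iteratedFDeriv_mul_le (N := ∞) ha f.contDiff x (by exact_mod_cast le_top)).trans ?_
  rw [Finset.sum_mul]
  refine Finset.sum_le_sum fun k hk => ?_
  refine mul_le_mul (mul_le_mul_of_nonneg_left (hB k x hx) (Nat.cast_nonneg _)) ?_
    (norm_nonneg _) (mul_nonneg (Nat.cast_nonneg _) (hB0 k))
  refine (ContDiffMapSupportedIn.norm_iteratedFDeriv_apply_le_seminorm_top ℝ).trans ?_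
  exact Seminorm.le_def.1 (Finset.le_sup
    (f := fun j => ContDiffMapSupportedIn.seminorm ℝ (Bos m) ℝ ⊤ K j)
    (Finset.mem_range.2 (by omega : i - k < i + 1))) f

/-- The continuous operator `f ↦ a f` on the test functions supported in a compact set. -/
def mulSupportedIn {m : ℕ} (a : Smooth m) (K : TopologicalSpace.Compacts (Bos m)) :
    𝓓_{K}(Bos m, ℝ) →L[ℝ] 𝓓_{K}(Bos m, ℝ) :=
  ContDiffMapSupportedIn.mkCLM ℝ (fun f y => a.1 y * f y)
    (fun f g x => by simp [mul_add])
    (fun c f x => by simp [mul_left_comm])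
    (fun f => ContDiff.mul a.2 f.contDiff)
    (fun f x hx => by simp [f.zero_on_compl hx])
    (fun i _ => smooth_mul_bound a K i)

/-- The product `a f` of a smooth function and a test function. -/
def mulTestFun {m : ℕ} (a : Smooth m) (f : Test m) : Test m :=
  ⟨fun y => a.1 y * f y, ContDiff.mul a.2 f.contDiff, f.hasCompactSupport.mul_left,
    fun _ _ => trivial⟩

/-- The continuous operator `f ↦ a f` on test functions. -/
def mulTest {m : ℕ} (a : Smooth m) : Test m →L[ℝ] Test m :=
  TestFunction.limitCLM ℝ (mulTestFun a)
    (fun K hK => (TestFunction.ofSupportedInCLM ℝ hK).comp (mulSupportedIn a K))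
    (fun _ _ _ => rfl)

/-- The product `a T` of a smooth function `a` and a distribution `T`, `⟨a T, f⟩ = ⟨T, a f⟩`,
as a bilinear map. -/
def mulDist (m : ℕ) : Smooth m →ₗ[ℝ] Dist m →ₗ[ℝ] Dist m :=
  LinearMap.mk₂ ℝ (fun a T => (mulTest a).precompCompactConvergenceCLM ℝ T)
    (fun a b T => by
      ext f
      change T (mulTest (a + b) f) = T (mulTest a f) + T (mulTest b f)
      rw [← map_add]
      congr 1
      ext x
      exact add_mul (a.1 x) (b.1 x) (f x))
    (fun c a T => by
      ext f
      change T (mulTest (c • a) f) = c • T (mulTest a f)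
      rw [← map_smul]
      congr 1
      ext x
      exact mul_assoc c (a.1 x) (f x))
    (fun a T S => map_add _ T S)
    (fun c a T => map_smul _ c T)

theorem mulTest_apply {m : ℕ} (a : Smooth m) (f : Test m) (x : Bos m) :
    mulTest a f x = a.1 x * f x := rfl

theorem mulDist_apply {m : ℕ} (a : Smooth m) (T : Dist m) (f : Test m) :
    mulDist m a T f = T (mulTest a f) := rfl

/-! ### Superfunctions and superdistributions -/

/-- The Grassmann algebra `𝔊_{2n}` generated by `2n` anticommuting variables. -/
abbrev Grass (n : ℕ) : Type := ExteriorAlgebra ℝ (Fin (2 * n) → ℝ)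

/-- The algebra of smooth superfunctions `C^∞(ℝ^m) ⊗ 𝔊_{2n}`. -/
abbrev SuperFun (m n : ℕ) : Type := Smooth m ⊗[ℝ] Grass n

/-- The space of superdistributions `𝓓' ⊗ 𝔊_{2n}`. -/
abbrev SuperDist (m n : ℕ) : Type := Dist m ⊗[ℝ] Grass n

/-- The subalgebra `𝔊_{2n}^{(ev)}` of even elements of the Grassmann algebra. -/
def evenGrass (n : ℕ) : Subalgebra ℝ (Grass n) :=
  CliffordAlgebra.even (0 : QuadraticForm ℝ (Fin (2 * n) → ℝ))

/-- The even superfunctions `C^∞(ℝ^m) ⊗ 𝔊_{2n}^{(ev)}`. -/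
def evenSuperFun (m n : ℕ) : Subalgebra ℝ (SuperFun m n) :=
  (Algebra.TensorProduct.map (AlgHom.id ℝ (Smooth m)) (evenGrass n).val).range

/-- The body `F_0` of a superfunction `F`: its component along `1 ∈ 𝔊_{2n}`. -/
def body {m n : ℕ} : SuperFun m n →ₐ[ℝ] Smooth m :=
  (Algebra.TensorProduct.rid ℝ ℝ (Smooth m)).toAlgHom.comp
    (Algebra.TensorProduct.map (AlgHom.id ℝ (Smooth m)) ExteriorAlgebra.algebraMapInv)

/-- The nilpotent part `F - F_0` of a superfunction `F`. -/
def nilPart {m n : ℕ} (F : SuperFun m n) : SuperFun m n := F - body F ⊗ₜ[ℝ] 1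

/-- The product of a superfunction and a superdistribution, the bilinear map determined by
`(a ⊗ u) (T ⊗ v) = (a T) ⊗ (u v)`. -/
def superMul (m n : ℕ) : SuperFun m n →ₗ[ℝ] SuperDist m n →ₗ[ℝ] SuperDist m n :=
  TensorProduct.map₂ (mulDist m) (LinearMap.mul ℝ (Grass n))

/-! ### The distributions `δ^{(j)}(g_0)` and `δ^{(k)}(g)` -/

/-- `T = δ^{(j)}(g₀)`, the composition of the `j`-th derivative of the Dirac distribution of `ℝ`
with the smooth function `g₀`. It is the extension of the composition `u ↦ u ∘ g₀` from functions
`u` to `u = δ^{(j)}` by regularization: `T` is the limit in `𝓓'`, as `ε → 0+`, of the functions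
`η_ε^{(j)} ∘ g₀`, where `η_ε(t) = ε⁻¹ η(ε⁻¹ t)`, for every `η ∈ C^∞_0(ℝ)` with integral one. -/
def IsDeltaComp {m : ℕ} (j : ℕ) (g₀ : Smooth m) (T : Dist m) : Prop :=
  ∀ η : ℝ → ℝ, ContDiff ℝ ∞ η → HasCompactSupport η → ∫ t, η t = 1 →
    ∀ f : Test m, Filter.Tendsto
      (fun ε : ℝ => ∫ x : Bos m, iteratedDeriv j (fun t => ε⁻¹ * η (ε⁻¹ * t)) (g₀.1 x) * f x)
      (𝓝[>] 0) (𝓝 (T f))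

/-- There is at most one distribution `δ^{(j)}(g₀)`. -/
theorem IsDeltaComp.unique {m : ℕ} {j : ℕ} {g₀ : Smooth m} {T S : Dist m}
    (hT : IsDeltaComp j g₀ T) (hS : IsDeltaComp j g₀ S) : T = S := by
  let b : ContDiffBump (0 : ℝ) := ⟨1, 2, one_pos, one_lt_two⟩
  ext f
  exact tendsto_nhds_unique
    (hT (b.normed MeasureTheory.volume) b.contDiff_normed b.hasCompactSupport_normed
      b.integral_normed f)
    (hS (b.normed MeasureTheory.volume) b.contDiff_normed b.hasCompactSupport_normed
      b.integral_normed f)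

open Classical in
/-- The distribution `δ^{(j)}(g₀)` (with the value `0` if it does not exist). -/
def deltaComp {m : ℕ} (j : ℕ) (g₀ : Smooth m) : Dist m :=
  if h : ∃ T, IsDeltaComp j g₀ T then h.choose else 0

/-- The superdistribution `δ^{(k)}(g) = ∑_{j=0}^n (𝐠^j / j!) δ^{(k+j)}(g_0)`, where `g_0` and `𝐠`
are the body and the nilpotent part of `g`. -/
def superDelta {m n : ℕ} (k : ℕ) (g : SuperFun m n) : SuperDist m n :=
  ∑ j ∈ Finset.range (n + 1),
    superMul m n ((j.factorial : ℝ)⁻¹ • nilPart g ^ j) (deltaComp (k + j) (body g) ⊗ₜ[ℝ] 1)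

end Superspace

end

noncomputable section

namespace Superspace

/-! ### A nilpotent binomial identity -/

/-! The proof separates into an analytic statement about bodies and a formal computation with
nilpotents.

Analytically, for regular `G` the distributions `D_j = δ^{(j)}(G)` exist and satisfy `G D_{j+1} =
-(j+1) D_j`, and for positive `h` one has `δ^{(j)}(hG) = h^{-(j+1)} δ^{(j)}(G)`. The tool is a
vector field `V` with `VG = 1` near the zero set (`exists_transversal`). Integrating by parts along
it trades each derivative of the mollifier for a factor `ε`, and reduces every limit to the
Heaviside distribution `θ(G)` (`tendsto_deltaAlong`). Since `θ(hG) = θ(G)`, applying `V` once gives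
the scaling rule for `j = 0`; applying it repeatedly gives all `j` (`Regular.deltaComp_mul`).

Algebraically, write `x` for the body of `g`, `a` for its nilpotent part, and `1 + k` for `h`
divided by its body. The scaling rule absorbs the body of `h`, and what remains is `(1+k)
δ((1+k)(x+a)) = δ(x+a)`, where both sides are Taylor sums at `x` and the increment on the left is
`(1+k)a + kx`. By the recursion, `x^q D_{p+q}` is a multiple of `D_p`, so the coefficient of each
`D_p` is a binomial series in `-k` with sum `(1+k)^{-(p+1)}` (`smul_sum_range_of_recursion`). Even
superfunctions are central and their nilpotent parts have vanishing `(n+1)`-st power, which makes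
the manipulations legitimate and the series finite. -/

theorem one_sub_mul_sum_choose {A : Type*} [CommRing A] (y : A) (p Q : ℕ) :
    (1 - y) * ∑ q ∈ Finset.range Q, ((p + 1 + q).choose (p + 1) : A) * y ^ q =
      ∑ q ∈ Finset.range Q, ((p + q).choose p : A) * y ^ q - ((p + Q).choose (p + 1) : A) * y ^ Q := by
  induction Q with
  | zero => simp
  | succ Q ih =>
    rw [Finset.sum_range_succ, Finset.sum_range_succ, mul_add, ih]
    have h : (p + 1 + Q).choose (p + 1) = (p + Q).choose p + (p + Q).choose (p + 1) := by
      rw [add_right_comm, Nat.choose_succ_succ]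
    have h' : (p + (Q + 1)).choose (p + 1) = (p + Q).choose p + (p + Q).choose (p + 1) := by
      rw [← add_assoc, Nat.choose_succ_succ]
    rw [h, h']
    push_cast
    ring

/-- This is the expansion of `(1 - y)^{-(p+1)}` for nilpotent `y`. By Pascal's rule, each factor `1
- y` lowers `p` by one, up to a boundary term in `y ^ Q`. -/
theorem one_sub_pow_mul_sum_choose {A : Type*} [CommRing A] {y : A} {Q : ℕ} (hy : y ^ Q = 0)
    (p : ℕ) :
    (1 - y) ^ (p + 1) * ∑ q ∈ Finset.range Q, ((p + q).choose p : A) * y ^ q = 1 := by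
  induction p with
  | zero => simpa [hy] using mul_neg_geom_sum y Q
  | succ p ih => rw [pow_succ, mul_assoc, one_sub_mul_sum_choose, hy, mul_zero, sub_zero, ih]

/-! ### Taylor sums of a sequence obeying the recursion of the derivatives of `δ`. -/

section AbstractDelta

variable {A M : Type*} [CommRing A] [AddCommGroup M] [Module A M]

theorem pow_smul_of_recursion {D : ℕ → M} {x : A}
    (hD : ∀ j, x • D (j + 1) = -(((j + 1 : ℕ) : A) • D j)) (p q : ℕ) :
    x ^ q • D (p + q) = ((-1) ^ q * ((p + q).descFactorial q : A)) • D p := by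
  induction q with
  | zero => simp
  | succ q ih =>
    rw [pow_succ, mul_smul, ← add_assoc, hD, smul_neg, smul_comm, ih, ← neg_smul, smul_smul,
      Nat.succ_descFactorial_succ]
    push_cast
    congr 1
    ring

/-- Formally `(1+k) δ((1+k)(x+a)) = δ(x+a)`, because `x + ((1+k)a + kx) = (1+k)(x+a)`. The length
`2n+2` leaves room for a power up to `n` of `a` together with one up to `n` of `k`. -/
theorem smul_sum_range_of_recursion [Algebra ℝ A] {D : ℕ → M} {x a k : A} {n : ℕ}
    (hD : ∀ j, x • D (j + 1) = -(((j + 1 : ℕ) : A) • D j))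
    (ha : a ^ (n + 1) = 0) (hk : k ^ (n + 1) = 0) :
    (1 + k) • ∑ j ∈ Finset.range (2 * n + 2),
        ((j.factorial : ℝ)⁻¹ • ((1 + k) * a + k * x) ^ j) • D j =
      ∑ j ∈ Finset.range (2 * n + 2), ((j.factorial : ℝ)⁻¹ • a ^ j) • D j := by
  have key (j : ℕ) : ((j.factorial : ℝ)⁻¹ • ((1 + k) * a + k * x) ^ j) • D j =
      ∑ p ∈ Finset.range (j + 1),
        ((((p.factorial : ℝ)⁻¹ • ((1 + k) * a) ^ p) *
          (((j - p).factorial : ℝ)⁻¹ • (k ^ (j - p)))) * x ^ (j - p)) • D (p + (j - p)) := by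
    rw [add_pow, Finset.smul_sum, Finset.sum_smul]
    refine Finset.sum_congr rfl fun p hp => ?_
    have hp' : p ≤ j := by simpa [Nat.lt_succ_iff] using hp
    rw [Nat.add_sub_cancel' hp']
    congr 1
    rw [← map_natCast (algebraMap ℝ A), mul_comm _ (algebraMap ℝ A _), ← Algebra.smul_def,
      smul_smul,
      smul_mul_smul_comm, smul_mul_assoc, mul_pow k, mul_assoc]
    congr 1
    rw [Nat.cast_choose ℝ hp']
    field_simp
  -- The triangle `p + q < 2n+2` is summed by rows of fixed `p`, the exponent of `(1+k)a`.
  rw [Finset.sum_congr rfl fun j _ => key j,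
    Finset.sum_range_diag_flip (2 * n + 2) fun p q =>
      ((((p.factorial : ℝ)⁻¹ • ((1 + k) * a) ^ p) *
          ((q.factorial : ℝ)⁻¹ • (k ^ q))) * x ^ q) • D (p + q), Finset.smul_sum]
  refine Finset.sum_congr rfl fun p _ => ?_
  by_cases hp : n + 1 ≤ p
  · simp [mul_pow, pow_eq_zero_of_le hp ha]
  -- For `p ≤ n` the row has at least `n + 2` entries, so truncation loses no nonzero power of `k`.
  have hQ : (-k) ^ (2 * n + 2 - p) = 0 := by
    rw [neg_pow, pow_eq_zero_of_le (by omega) hk, mul_zero]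
  have hterm (q : ℕ) : ((((p.factorial : ℝ)⁻¹ • ((1 + k) * a) ^ p) *
      ((q.factorial : ℝ)⁻¹ • (k ^ q))) * x ^ q) • D (p + q) =
      (((p.factorial : ℝ)⁻¹ • ((1 + k) * a) ^ p) * (((p + q).choose p : A) * (-k) ^ q)) • D p := by
    rw [mul_smul, pow_smul_of_recursion hD, smul_smul, mul_assoc]
    congr 2
    have : ((p + q).descFactorial q : A) = algebraMap ℝ A ((p + q).descFactorial q : ℝ) := by simp
    have h2 : ((p + q).choose p : A) = algebraMap ℝ A ((p + q).choose p : ℝ) := by simp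
    have h3 : ((p + q).choose p : ℝ) = ((q.factorial : ℝ)⁻¹ * ((p + q).descFactorial q : ℝ)) := by
      rw [Nat.descFactorial_eq_factorial_mul_choose, Nat.choose_symm_add]
      push_cast
      field_simp
    rw [this, h2, h3, neg_pow k, Algebra.smul_def, map_mul]
    ring
  rw [Finset.sum_congr rfl fun q _ => hterm q, ← Finset.sum_smul, ← Finset.mul_sum, smul_smul]
  have := one_sub_pow_mul_sum_choose hQ p
  rw [sub_neg_eq_add] at this
  congr 1
  rw [Algebra.smul_def, Algebra.smul_def, mul_pow]
  linear_combination (algebraMap ℝ A (p.factorial : ℝ)⁻¹ * a ^ p) * this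

end AbstractDelta

/-! ### Even elements of the Grassmann algebra -/

/-- A product of two generators passes any third one by two sign changes, and such products generate
the even subalgebra. -/
theorem evenGrass_le_center (n : ℕ) : evenGrass n ≤ Subalgebra.center ℝ (Grass n) := by
  intro x hx
  have hι (a b c : Fin (2 * n) → ℝ) :
      ExteriorAlgebra.ι ℝ a * ExteriorAlgebra.ι ℝ b * ExteriorAlgebra.ι ℝ c =
        ExteriorAlgebra.ι ℝ c * (ExteriorAlgebra.ι ℝ a * ExteriorAlgebra.ι ℝ b) := by
    have h1 := ExteriorAlgebra.ι_add_mul_swap (R := ℝ) b c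
    have h2 := ExteriorAlgebra.ι_add_mul_swap (R := ℝ) a c
    rw [eq_comm, ← sub_eq_zero]
    calc _ = (ExteriorAlgebra.ι ℝ a * ExteriorAlgebra.ι ℝ c +
          ExteriorAlgebra.ι ℝ c * ExteriorAlgebra.ι ℝ a) * ExteriorAlgebra.ι ℝ b -
          ExteriorAlgebra.ι ℝ a * (ExteriorAlgebra.ι ℝ b * ExteriorAlgebra.ι ℝ c +
          ExteriorAlgebra.ι ℝ c * ExteriorAlgebra.ι ℝ b) := by noncomm_ring
      _ = 0 := by rw [h1, h2]; simp
  have hpair (a b : Fin (2 * n) → ℝ) :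
      ExteriorAlgebra.ι ℝ a * ExteriorAlgebra.ι ℝ b ∈ Subalgebra.center ℝ (Grass n) := by
    rw [Subalgebra.mem_center_iff]
    intro y
    induction y using ExteriorAlgebra.induction with
    | algebraMap r => exact Algebra.commutes _ _
    | ι c => exact (hι a b c).symm
    | mul y z hy hz => rw [mul_assoc, hz, ← mul_assoc, hy, mul_assoc]
    | add y z hy hz => rw [add_mul, mul_add, hy, hz]
  have hx' : x ∈ CliffordAlgebra.evenOdd (0 : QuadraticForm ℝ (Fin (2 * n) → ℝ)) 0 := hx
  clear hx
  induction x, hx' using CliffordAlgebra.even_induction with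
  | algebraMap r => exact Subalgebra.algebraMap_mem _ r
  | add x y hx hy ihx ihy => exact add_mem ihx ihy
  | ι_mul_ι_mul a b x hx ih => exact mul_mem (hpair a b) ih

/-- The span of the elements of degree at least `d`. -/
def gradeGE (n d : ℕ) : Submodule ℝ (Grass n) :=
  ⨆ i : {i : ℕ // d ≤ i}, ⋀[ℝ]^(i : ℕ) (Fin (2 * n) → ℝ)

theorem exteriorPower_le_gradeGE {n d i : ℕ} (h : d ≤ i) :
    ⋀[ℝ]^i (Fin (2 * n) → ℝ) ≤ gradeGE n d :=
  le_iSup (fun i : {i : ℕ // d ≤ i} => ⋀[ℝ]^(i : ℕ) (Fin (2 * n) → ℝ)) ⟨i, h⟩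

theorem gradeGE_mul_le (n d e : ℕ) : gradeGE n d * gradeGE n e ≤ gradeGE n (d + e) := by
  rw [gradeGE, gradeGE, Submodule.iSup_mul]
  refine iSup_le fun i => ?_
  rw [Submodule.mul_iSup]
  refine iSup_le fun j => ?_
  rw [← pow_add]
  exact exteriorPower_le_gradeGE (add_le_add i.2 j.2)

theorem gradeGE_zero (n : ℕ) : gradeGE n 0 = ⊤ := by
  rw [eq_top_iff, ← (DirectSum.Decomposition.isInternal
    fun i : ℕ => ⋀[ℝ]^i (Fin (2 * n) → ℝ)).submodule_iSup_eq_top]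
  exact iSup_le fun i => exteriorPower_le_gradeGE (Nat.zero_le i)

theorem gradeGE_eq_bot {n d : ℕ} (h : 2 * n < d) : gradeGE n d = ⊥ := by
  rw [gradeGE, eq_bot_iff]
  refine iSup_le fun i => le_of_eq ?_
  rw [← Submodule.finrank_eq_zero (R := ℝ), exteriorPower.finrank_eq, Module.finrank_fin_fun]
  exact Nat.choose_eq_zero_of_lt (h.trans_le i.2)

/-- Evenness excludes degree one, so what is left after the constant term starts in degree two. This
doubling is why `n + 1` factors suffice to kill the nilpotent part with `2n` generators. -/
theorem sub_algebraMapInv_mem_gradeGE {n : ℕ} {x : Grass n} (hx : x ∈ evenGrass n) :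
    x - algebraMap ℝ _ (ExteriorAlgebra.algebraMapInv x) ∈ gradeGE n 2 := by
  have hx' : x ∈ CliffordAlgebra.evenOdd (0 : QuadraticForm ℝ (Fin (2 * n) → ℝ)) 0 := hx
  clear hx
  induction x, hx' using CliffordAlgebra.even_induction with
  | algebraMap r =>
    have : ExteriorAlgebra.algebraMapInv (algebraMap ℝ (Grass n) r) = r :=
      ExteriorAlgebra.algebraMap_leftInverse _ r
    erw [this]
    simp
  | add x y hx hy ihx ihy =>
    rw [map_add, map_add, add_sub_add_comm]
    exact add_mem ihx ihy
  | ι_mul_ι_mul a b x hx ih =>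
    have h0 : ExteriorAlgebra.algebraMapInv
        (ExteriorAlgebra.ι ℝ a * ExteriorAlgebra.ι ℝ b * x) = 0 := by
      simp [ExteriorAlgebra.algebraMapInv]
    change ExteriorAlgebra.ι ℝ a * ExteriorAlgebra.ι ℝ b * x - algebraMap ℝ _
      (ExteriorAlgebra.algebraMapInv (ExteriorAlgebra.ι ℝ a * ExteriorAlgebra.ι ℝ b * x)) ∈ _
    rw [h0, map_zero, sub_zero]
    refine gradeGE_mul_le n 2 0 (Submodule.mul_mem_mul ?_ (gradeGE_zero n ▸ Submodule.mem_top))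
    refine exteriorPower_le_gradeGE le_rfl ?_
    change _ ∈ LinearMap.range (ExteriorAlgebra.ι ℝ (M := Fin (2 * n) → ℝ)) ^ 2
    rw [pow_two]
    exact Submodule.mul_mem_mul (LinearMap.mem_range_self _ a) (LinearMap.mem_range_self _ b)

/-! ### Even superfunctions -/

theorem evenSuperFun_induction {m n : ℕ} {p : SuperFun m n → Prop}
    (tmul : ∀ a, ∀ u ∈ evenGrass n, p (a ⊗ₜ u)) (zero : p 0)
    (add : ∀ F G, p F → p G → p (F + G)) {F : SuperFun m n} (hF : F ∈ evenSuperFun m n) : p F := by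
  obtain ⟨t, rfl⟩ := hF
  induction t using TensorProduct.induction_on with
  | zero => simpa using zero
  | tmul a u => exact tmul a u.1 u.2
  | add s t hs ht => rw [map_add]; exact add _ _ hs ht

theorem tmul_mem_center {m n : ℕ} (a : Smooth m) {u : Grass n}
    (hu : u ∈ Subalgebra.center ℝ (Grass n)) :
    (a ⊗ₜ[ℝ] u : SuperFun m n) ∈ Subalgebra.center ℝ (SuperFun m n) := by
  rw [Subalgebra.mem_center_iff] at hu ⊢
  intro y
  induction y using TensorProduct.induction_on with
  | zero => simp
  | tmul b v =>
    rw [Algebra.TensorProduct.tmul_mul_tmul b a v u, Algebra.TensorProduct.tmul_mul_tmul a b u v]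
    exact congrArg₂ (fun c w => (c ⊗ₜ[ℝ] w : SuperFun m n)) (mul_comm b a) (hu v)
  | add s t hs ht => rw [add_mul, mul_add, hs, ht]

theorem evenSuperFun_le_center (m n : ℕ) :
    evenSuperFun m n ≤ Subalgebra.center ℝ (SuperFun m n) := fun _ hF =>
  evenSuperFun_induction (fun a _ hu => tmul_mem_center a (evenGrass_le_center n hu))
    (zero_mem _) (fun _ _ => add_mem) hF

/-- The superfunctions of degree at least `d` in the Grassmann generators. -/
def superGradeGE (m n d : ℕ) : Submodule ℝ (SuperFun m n) :=
  Submodule.span ℝ {F | ∃ (a : Smooth m) (u : Grass n), u ∈ gradeGE n d ∧ a ⊗ₜ[ℝ] u = F}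

theorem superGradeGE_mul_le (m n d e : ℕ) :
    superGradeGE m n d * superGradeGE m n e ≤ superGradeGE m n (d + e) := by
  rw [superGradeGE, superGradeGE, Submodule.span_mul_span, Submodule.span_le]
  rintro _ ⟨_, ⟨a, u, hu, rfl⟩, _, ⟨b, v, hv, rfl⟩, rfl⟩
  exact Submodule.subset_span ⟨a * b, u * v, gradeGE_mul_le n d e (Submodule.mul_mem_mul hu hv),
    (Algebra.TensorProduct.tmul_mul_tmul a b u v).symm⟩

theorem pow_mem_superGradeGE {m n d : ℕ} {F : SuperFun m n} (hF : F ∈ superGradeGE m n d) (k : ℕ) :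
    F ^ (k + 1) ∈ superGradeGE m n (d * (k + 1)) := by
  induction k with
  | zero => simpa using hF
  | succ k ih =>
    rw [pow_succ, mul_add_one d]
    exact superGradeGE_mul_le m n _ d (Submodule.mul_mem_mul ih hF)

theorem superGradeGE_eq_bot {m n d : ℕ} (h : 2 * n < d) : superGradeGE m n d = ⊥ := by
  rw [superGradeGE, Submodule.span_eq_bot]
  rintro _ ⟨a, u, hu, rfl⟩
  rw [gradeGE_eq_bot h, Submodule.mem_bot] at hu
  rw [hu, TensorProduct.tmul_zero]

theorem body_tmul {m n : ℕ} (a : Smooth m) (u : Grass n) :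
    body (a ⊗ₜ[ℝ] u) = ExteriorAlgebra.algebraMapInv u • a := by
  simp [body]

instance superFunAddCommGroup (m n : ℕ) : AddCommGroup (SuperFun m n) :=
  (inferInstance : Ring (SuperFun m n)).toAddCommGroup

theorem nilPart_add {m n : ℕ} (F G : SuperFun m n) :
    nilPart (F + G) = nilPart F + nilPart G := by
  rw [nilPart, nilPart, nilPart, map_add, TensorProduct.add_tmul, add_sub_add_comm]

theorem nilPart_mem_superGradeGE {m n : ℕ} {F : SuperFun m n} (hF : F ∈ evenSuperFun m n) :
    nilPart F ∈ superGradeGE m n 2 := by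
  refine evenSuperFun_induction (p := fun F => nilPart F ∈ superGradeGE m n 2)
    (fun a u hu => ?_) ?_ (fun F G hF hG => ?_) hF
  · refine Submodule.subset_span ⟨a, _, sub_algebraMapInv_mem_gradeGE hu, ?_⟩
    rw [nilPart, body_tmul, TensorProduct.tmul_sub, Algebra.algebraMap_eq_smul_one,
      TensorProduct.smul_tmul]
  · simp [nilPart]
  · rw [nilPart_add]
    exact add_mem hF hG

theorem nilPart_pow_eq_zero {m n : ℕ} {F : SuperFun m n} (hF : F ∈ evenSuperFun m n) :
    nilPart F ^ (n + 1) = 0 := by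
  have h := pow_mem_superGradeGE (nilPart_mem_superGradeGE hF) n
  rwa [superGradeGE_eq_bot (by omega), Submodule.mem_bot] at h

/-! ### The action of superfunctions on superdistributions -/

theorem mulDist_one (m : ℕ) (T : Dist m) : mulDist m 1 T = T := by
  ext f
  rw [mulDist_apply]
  congr 1
  ext x
  rw [mulTest_apply]
  exact one_mul (f x)

theorem mulDist_mul {m : ℕ} (a b : Smooth m) (T : Dist m) :
    mulDist m (a * b) T = mulDist m a (mulDist m b T) := by
  ext f
  rw [mulDist_apply, mulDist_apply, mulDist_apply]
  congr 1
  ext x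
  rw [mulTest_apply, mulTest_apply, mulTest_apply]
  change a.1 x * b.1 x * f x = _
  ring

theorem superMul_tmul {m n : ℕ} (a : Smooth m) (u : Grass n) (T : Dist m) (v : Grass n) :
    superMul m n (a ⊗ₜ u) (T ⊗ₜ v) = mulDist m a T ⊗ₜ (u * v) := rfl

theorem superMul_one (m n : ℕ) (S : SuperDist m n) : superMul m n 1 S = S := by
  induction S using TensorProduct.induction_on with
  | zero => rw [map_zero]
  | tmul T v =>
    rw [Algebra.TensorProduct.one_def, superMul_tmul, mulDist_one, one_mul]
  | add S T hS hT => rw [map_add, hS, hT]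

theorem superMul_mul {m n : ℕ} (F G : SuperFun m n) (S : SuperDist m n) :
    superMul m n (F * G) S = superMul m n F (superMul m n G S) := by
  induction S using TensorProduct.induction_on with
  | zero => simp
  | add S T hS hT => simp only [map_add, hS, hT]
  | tmul T w =>
    induction F using TensorProduct.induction_on with
    | zero => simp
    | add F F' hF hF' => simp only [add_mul, map_add, LinearMap.add_apply, hF, hF']
    | tmul a u =>
      induction G using TensorProduct.induction_on with
      | zero => simp
      | add G G' hG hG' => simp only [mul_add, map_add, LinearMap.add_apply, hG, hG']
      | tmul b v =>
        rw [Algebra.TensorProduct.tmul_mul_tmul, superMul_tmul, superMul_tmul, superMul_tmul,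
          mulDist_mul, mul_assoc]

/-- Superdistributions form a module over superfunctions. -/
instance superModule (m n : ℕ) : Module (SuperFun m n) (SuperDist m n) where
  smul F S := superMul m n F S
  one_smul := superMul_one m n
  mul_smul := superMul_mul
  smul_zero F := map_zero (superMul m n F)
  smul_add F := map_add (superMul m n F)
  add_smul F G S := by
    change superMul m n (F + G) S = superMul m n F S + superMul m n G S
    rw [map_add, LinearMap.add_apply]
  zero_smul S := by
    change superMul m n 0 S = 0
    rw [map_zero, LinearMap.zero_apply]

theorem super_smul_def {m n : ℕ} (F : SuperFun m n) (S : SuperDist m n) :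
    F • S = superMul m n F S := rfl

/-! ### The algebraic part of the scaling rule -/

/-- Passes between the length in the definition of `superDelta` and the length needed for the
rearrangement of the double sum. -/
theorem sum_range_eq_of_pow_eq_zero {A M : Type*} [Ring A] [Algebra ℝ A] [AddCommGroup M]
    [Module A M] {a : A} {n : ℕ} (ha : a ^ (n + 1) = 0) (D : ℕ → M) :
    ∑ j ∈ Finset.range (n + 1), ((j.factorial : ℝ)⁻¹ • a ^ j) • D j =
      ∑ j ∈ Finset.range (2 * n + 2), ((j.factorial : ℝ)⁻¹ • a ^ j) • D j := by
  refine Finset.sum_subset (Finset.range_mono (by omega)) fun j _ hj => ?_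
  rw [pow_eq_zero_of_le (by simpa using hj) ha, smul_zero, zero_smul]

/-- Here `X + a`, `Y + b` stand for `g`, `h` split into body and nilpotent part, `Z` for the inverse
body of `h`, and `c` for the nilpotent part of `hg`. The powers of `Z` are absorbed into `Z * c`,
which is `(1+k)a + kX` with `k = Z * b`. -/
theorem smul_sum_scaled_of_comm {A M : Type*} [CommRing A] [Algebra ℝ A] [AddCommGroup M]
    [Module A M] {X Y Z a b c : A} {n : ℕ} {D : ℕ → M} (hYZ : Y * Z = 1)
    (hc : c = (Y + b) * (X + a) - Y * X)
    (ha : a ^ (n + 1) = 0) (hb : b ^ (n + 1) = 0) (hc0 : c ^ (n + 1) = 0)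
    (hrec : ∀ j, X • D (j + 1) = -((j + 1) • D j)) :
    (Y + b) • ∑ j ∈ Finset.range (n + 1), ((j.factorial : ℝ)⁻¹ • c ^ j) • Z ^ (j + 1) • D j =
      ∑ j ∈ Finset.range (n + 1), ((j.factorial : ℝ)⁻¹ • a ^ j) • D j := by
  have hZc : Z * c = (1 + Z * b) * a + Z * b * X := by
    rw [hc]
    linear_combination a * hYZ
  rw [sum_range_eq_of_pow_eq_zero ha,
    ← smul_sum_range_of_recursion (k := Z * b) (x := X)
      (fun j => by rw [hrec, Nat.cast_smul_eq_nsmul]) ha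
      (by rw [mul_pow, hb, mul_zero]),
    ← hZc, ← sum_range_eq_of_pow_eq_zero (by rw [mul_pow, hc0, mul_zero])]
  rw [Finset.smul_sum, Finset.smul_sum]
  refine Finset.sum_congr rfl fun j _ => ?_
  rw [smul_smul, smul_smul, smul_smul]
  congr 1
  rw [mul_smul_comm, smul_mul_assoc, mul_smul_comm]
  congr 1
  rw [mul_pow]
  linear_combination (Z ^ j * c ^ j) * hYZ

theorem smul_sum_scaled {A M : Type*} [Ring A] [Algebra ℝ A] [AddCommGroup M]
    [Module A M] {X Y Z a b c : A} {n : ℕ} {D : ℕ → M} (hYZ : Y * Z = 1)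
    (hc : c = (Y + b) * (X + a) - Y * X)
    (hXA : X ∈ Subalgebra.center ℝ A) (hYA : Y ∈ Subalgebra.center ℝ A)
    (hZA : Z ∈ Subalgebra.center ℝ A) (haA : X + a ∈ Subalgebra.center ℝ A)
    (hbA : Y + b ∈ Subalgebra.center ℝ A)
    (ha : a ^ (n + 1) = 0) (hb : b ^ (n + 1) = 0) (hc0 : c ^ (n + 1) = 0)
    (hrec : ∀ j, X • D (j + 1) = -((j + 1) • D j)) :
    (Y + b) • ∑ j ∈ Finset.range (n + 1), ((j.factorial : ℝ)⁻¹ • c ^ j) • Z ^ (j + 1) • D j =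
      ∑ j ∈ Finset.range (n + 1), ((j.factorial : ℝ)⁻¹ • a ^ j) • D j := by
  have haA : a ∈ Subalgebra.center ℝ A := by simpa using sub_mem haA hXA
  have hbA : b ∈ Subalgebra.center ℝ A := by simpa using sub_mem hbA hYA
  have hcA : c ∈ Subalgebra.center ℝ A :=
    hc ▸ sub_mem (mul_mem (add_mem hYA hbA) (add_mem hXA haA)) (mul_mem hYA hXA)
  -- All elements involved are central, so the commutative case applies over the center, with `M`
  -- regarded as a module over it.
  exact smul_sum_scaled_of_comm (A := Subalgebra.center ℝ A) (X := ⟨X, hXA⟩) (Y := ⟨Y, hYA⟩)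
    (Z := ⟨Z, hZA⟩) (a := ⟨a, haA⟩) (b := ⟨b, hbA⟩) (c := ⟨c, hcA⟩) (Subtype.ext hYZ)
    (Subtype.ext hc) (Subtype.ext ha) (Subtype.ext hb) (Subtype.ext hc0) hrec

theorem smooth_tmul_mem_center {m n : ℕ} (a : Smooth m) :
    (a ⊗ₜ[ℝ] 1 : SuperFun m n) ∈ Subalgebra.center ℝ (SuperFun m n) :=
  tmul_mem_center a (one_mem _)

theorem smooth_tmul_smul {m n : ℕ} (a : Smooth m) (T : Dist m) :
    (a ⊗ₜ[ℝ] 1 : SuperFun m n) • (T ⊗ₜ[ℝ] 1 : SuperDist m n) = mulDist m a T ⊗ₜ[ℝ] 1 := by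
  rw [super_smul_def, superMul_tmul, one_mul]

theorem smooth_tmul_mul {m n : ℕ} (a b : Smooth m) :
    (a ⊗ₜ[ℝ] 1 : SuperFun m n) * b ⊗ₜ[ℝ] 1 = (a * b) ⊗ₜ[ℝ] 1 := by
  rw [Algebra.TensorProduct.tmul_mul_tmul a b 1 1, one_mul]

theorem smooth_tmul_pow {m n : ℕ} (a : Smooth m) (j : ℕ) :
    (a ⊗ₜ[ℝ] 1 : SuperFun m n) ^ j = (a ^ j) ⊗ₜ[ℝ] 1 := by
  rw [Algebra.TensorProduct.tmul_pow, one_pow]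

theorem body_add_nilPart {m n : ℕ} (F : SuperFun m n) : body F ⊗ₜ[ℝ] 1 + nilPart F = F :=
  add_sub_cancel _ _

/-- A unit plus a commuting nilpotent is a unit. -/
theorem isUnit_of_mem_evenSuperFun {m n : ℕ} {h : SuperFun m n} (hh : h ∈ evenSuperFun m n)
    {y : Smooth m} (hy : body h * y = 1) : IsUnit h := by
  have hyy : y * body h = 1 := (mul_comm _ _).trans hy
  have hu : IsUnit (body h ⊗ₜ[ℝ] 1 : SuperFun m n) :=
    isUnit_iff_exists.2 ⟨y ⊗ₜ[ℝ] 1,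
      by rw [smooth_tmul_mul, hy, Algebra.TensorProduct.one_def],
      by rw [smooth_tmul_mul, hyy, Algebra.TensorProduct.one_def]⟩
  have hn : IsNilpotent (nilPart h) := ⟨n + 1, nilPart_pow_eq_zero hh⟩
  have := IsNilpotent.isUnit_add_left_of_commute (R := SuperFun m n) hn hu
    (Subalgebra.mem_center_iff.1 (smooth_tmul_mem_center (body h)) (nilPart h))
  rwa [body_add_nilPart] at this

theorem smul_superDelta_mul {m n : ℕ} {g h : SuperFun m n} (hg : g ∈ evenSuperFun m n)
    (hh : h ∈ evenSuperFun m n) {y : Smooth m} (hy : body h * y = 1)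
    (hD : ∀ j, mulDist m (body g) (deltaComp (j + 1) (body g)) =
      -((j + 1) • deltaComp j (body g)))
    (hscale : ∀ j, deltaComp j (body (h * g)) =
      mulDist m (y ^ (j + 1)) (deltaComp j (body g))) :
    superMul m n h (superDelta 0 (h * g)) = superDelta 0 g := by
  have key := smul_sum_scaled (A := SuperFun m n) (M := SuperDist m n)
    (X := body g ⊗ₜ[ℝ] 1) (Y := body h ⊗ₜ[ℝ] 1) (Z := y ⊗ₜ[ℝ] 1) (a := nilPart g)
    (b := nilPart h) (c := nilPart (h * g)) (n := n)
    (D := fun j => deltaComp j (body g) ⊗ₜ[ℝ] 1)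
    (by rw [smooth_tmul_mul, hy, Algebra.TensorProduct.one_def])
    (by rw [body_add_nilPart, body_add_nilPart, smooth_tmul_mul, ← map_mul]; rfl)
    (smooth_tmul_mem_center _) (smooth_tmul_mem_center _) (smooth_tmul_mem_center _)
    (by rw [body_add_nilPart]; exact evenSuperFun_le_center m n hg)
    (by rw [body_add_nilPart]; exact evenSuperFun_le_center m n hh)
    (nilPart_pow_eq_zero hg) (nilPart_pow_eq_zero hh) (nilPart_pow_eq_zero (mul_mem hh hg))
    (fun j => by
      rw [smooth_tmul_smul, hD, TensorProduct.neg_tmul, TensorProduct.smul_tmul'])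
  rw [body_add_nilPart, super_smul_def] at key
  simp only [superDelta, zero_add]
  refine Eq.trans ?_ key
  congr 1
  refine Finset.sum_congr rfl fun j _ => ?_
  rw [hscale, smooth_tmul_pow, smooth_tmul_smul, super_smul_def]

theorem superDelta_mul {m n : ℕ} {g h : SuperFun m n} (hg : g ∈ evenSuperFun m n)
    (hh : h ∈ evenSuperFun m n) {y : Smooth m} (hy : body h * y = 1)
    (hD : ∀ j, mulDist m (body g) (deltaComp (j + 1) (body g)) =
      -((j + 1) • deltaComp j (body g)))
    (hscale : ∀ j, deltaComp j (body (h * g)) =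
      mulDist m (y ^ (j + 1)) (deltaComp j (body g))) :
    superDelta 0 (h * g) = superMul m n (Ring.inverse h) (superDelta 0 g) := by
  rw [← smul_superDelta_mul hg hh hy hD hscale, ← superMul_mul,
    Ring.inverse_mul_cancel h (isUnit_of_mem_evenSuperFun hh hy), superMul_one]

open MeasureTheory Filter

/-! ### Vector fields on `ℝ^m` -/

theorem smooth_contDiff {m : ℕ} (a : Smooth m) : ContDiff ℝ ∞ a.1 := a.2

theorem smooth_differentiable {m : ℕ} (a : Smooth m) : Differentiable ℝ a.1 :=
  (smooth_contDiff a).differentiable (by simp)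

/-- The unit vector in direction `i`. -/
abbrev unitVec {m : ℕ} (i : Fin m) : Bos m := EuclideanSpace.single i 1

/-- The partial derivative on `C^∞(ℝ^m)`. -/
def partialD {m : ℕ} (i : Fin m) : Derivation ℝ (Smooth m) (Smooth m) :=
  Derivation.mk'
    { toFun a := ⟨fun x => fderiv ℝ a.1 x (unitVec i),
        (((smooth_contDiff a).fderiv_right (m := ∞) (by simp)).clm_apply contDiff_const :)⟩
      map_add' a b := by
        ext x
        change fderiv ℝ (a.1 + b.1) x _ = fderiv ℝ a.1 x _ + fderiv ℝ b.1 x _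
        rw [fderiv_add (smooth_differentiable a x) (smooth_differentiable b x)]
        rfl
      map_smul' c a := by
        ext x
        change fderiv ℝ (c • a.1) x _ = c • fderiv ℝ a.1 x _
        rw [fderiv_const_smul (smooth_differentiable a x)]
        rfl }
    (fun a b => by
      ext x
      change fderiv ℝ (a.1 * b.1) x _ = a.1 x * fderiv ℝ b.1 x _ + b.1 x * fderiv ℝ a.1 x _
      rw [fderiv_mul (smooth_differentiable a x) (smooth_differentiable b x)]
      rfl)

theorem partialD_apply {m : ℕ} (i : Fin m) (a : Smooth m) (x : Bos m) :
    (partialD i a).1 x = fderiv ℝ a.1 x (unitVec i) := rfl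

/-- The derivation `∑ Vᵢ ∂ᵢ` of `C^∞(ℝ^m)` defined by a vector field. -/
def vectorField {m : ℕ} (V : Fin m → Smooth m) : Derivation ℝ (Smooth m) (Smooth m) :=
  ∑ i, V i • partialD i

theorem vectorField_eq {m : ℕ} (V : Fin m → Smooth m) (a : Smooth m) :
    vectorField V a = ∑ i, V i * partialD i a := by
  change Derivation.coeFnAddMonoidHom (∑ i, V i • partialD i) a = _
  rw [map_sum, Finset.sum_apply]
  rfl

theorem smooth_sum_apply {m : ℕ} {ι : Type*} (s : Finset ι) (a : ι → Smooth m) (x : Bos m) :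
    (∑ i ∈ s, a i).1 x = ∑ i ∈ s, (a i).1 x := by
  rw [AddSubmonoidClass.coe_finsetSum, Finset.sum_apply]

theorem vectorField_apply {m : ℕ} (V : Fin m → Smooth m) (a : Smooth m) (x : Bos m) :
    (vectorField V a).1 x = ∑ i, (V i).1 x * fderiv ℝ a.1 x (unitVec i) := by
  rw [vectorField_eq, smooth_sum_apply]
  rfl

theorem test_differentiable {m : ℕ} (f : Test m) : Differentiable ℝ f :=
  f.contDiff.differentiable (by simp)

/-- The partial derivative of test functions. -/
def partialTest {m : ℕ} (i : Fin m) : Test m →L[ℝ] Test m :=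
  TestFunction.lineDerivCLM ℝ (unitVec i)

theorem partialTest_apply {m : ℕ} (i : Fin m) (f : Test m) (x : Bos m) :
    partialTest i f x = fderiv ℝ f x (unitVec i) := by
  rw [partialTest, TestFunction.lineDerivCLM_apply_of_le (by simp),
    (test_differentiable f x).lineDeriv_eq_fderiv]

/-- The formal adjoint `f ↦ -∑ ∂ᵢ (Vᵢ f)` of a vector field. -/
def adjointField {m : ℕ} (V : Fin m → Smooth m) : Test m →L[ℝ] Test m :=
  -∑ i, (partialTest i).comp (mulTest (V i))

theorem test_sum_apply {m : ℕ} {ι : Type*} (s : Finset ι) (f : ι → Test m) (x : Bos m) :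
    (∑ i ∈ s, f i) x = ∑ i ∈ s, f i x := by
  classical
  induction s using Finset.induction_on with
  | empty => simp
  | insert i s hi ih => rw [Finset.sum_insert hi, Finset.sum_insert hi, ← ih]; rfl

theorem adjointField_apply {m : ℕ} (V : Fin m → Smooth m) (f : Test m) (x : Bos m) :
    adjointField V f x = -∑ i, fderiv ℝ (mulTest (V i) f) x (unitVec i) := by
  rw [adjointField, neg_apply, sum_apply]
  change -((∑ i, partialTest i (mulTest (V i) f)) x) = _
  rw [test_sum_apply]
  simp only [partialTest_apply]

theorem fderiv_mulTest {m : ℕ} (a : Smooth m) (f : Test m) (x v : Bos m) :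
    fderiv ℝ (mulTest a f) x v = a.1 x * fderiv ℝ f x v + f x * fderiv ℝ a.1 x v := by
  change fderiv ℝ (a.1 * (f : Bos m → ℝ)) x v = _
  rw [fderiv_mul (smooth_differentiable a x) (test_differentiable f x)]
  rfl

theorem mulTest_comm {m : ℕ} (a b : Smooth m) (f : Test m) :
    mulTest a (mulTest b f) = mulTest b (mulTest a f) := by
  ext x
  simp only [mulTest_apply]
  ring

theorem mulTest_mulTest {m : ℕ} (a b : Smooth m) (f : Test m) :
    mulTest a (mulTest b f) = mulTest (a * b) f := by
  ext x
  simp only [mulTest_apply]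
  exact (mul_assoc _ _ _).symm

theorem mulTest_add_left {m : ℕ} (a b : Smooth m) (f : Test m) :
    mulTest (a + b) f = mulTest a f + mulTest b f := by
  ext x
  exact add_mul (a.1 x) (b.1 x) (f x)

theorem mulTest_nsmul_left {m : ℕ} (k : ℕ) (a : Smooth m) (f : Test m) :
    mulTest (k • a) f = k • mulTest a f := by
  induction k with
  | zero =>
    ext x
    simp only [zero_smul]
    exact zero_mul (f x)
  | succ k ih => rw [succ_nsmul, succ_nsmul, mulTest_add_left, ih]

theorem mulTest_neg_left {m : ℕ} (a : Smooth m) (f : Test m) :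
    mulTest (-a) f = -mulTest a f := by
  ext x
  exact neg_mul (a.1 x) (f x)

/-- The Leibniz rule in dual form; on distributions it reads `V(aT) = a VT + (Va) T`. -/
theorem adjointField_mulTest {m : ℕ} (V : Fin m → Smooth m) (a : Smooth m) (f : Test m) :
    adjointField V (mulTest a f) =
      mulTest a (adjointField V f) - mulTest (vectorField V a) f := by
  ext x
  change _ = mulTest a (adjointField V f) x - mulTest (vectorField V a) f x
  rw [mulTest_apply, mulTest_apply, adjointField_apply, adjointField_apply, vectorField_apply,
    mul_neg, Finset.mul_sum, Finset.sum_mul, ← neg_add', ← Finset.sum_add_distrib]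
  congr 1
  refine Finset.sum_congr rfl fun i _ => ?_
  rw [mulTest_comm, fderiv_mulTest, mulTest_apply]
  ring

theorem test_integrable_mul {m : ℕ} {w : Bos m → ℝ} (hw : Continuous w) (f : Test m) :
    Integrable (fun x => w x * f x) :=
  (hw.mul f.continuous).integrable_of_hasCompactSupport f.hasCompactSupport.mul_left

theorem integral_vectorField_mul {m : ℕ} (V : Fin m → Smooth m) (w : Smooth m) (f : Test m) :
    ∫ x, (vectorField V w).1 x * f x = ∫ x, w.1 x * adjointField V f x := by
  have hw : ∀ i : Fin m, Continuous fun x => fderiv ℝ w.1 x (unitVec i) := fun i =>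
    (smooth_contDiff (partialD i w)).continuous
  have hf : ∀ i : Fin m, Continuous fun x => fderiv ℝ (mulTest (V i) f) x (unitVec i) := fun i => by
    simpa only [← partialTest_apply] using (partialTest i (mulTest (V i) f)).continuous
  have hint (i : Fin m) : Integrable fun x => w.1 x * fderiv ℝ (mulTest (V i) f) x (unitVec i) := by
    simpa only [← partialTest_apply] using
      test_integrable_mul (smooth_contDiff w).continuous (partialTest i (mulTest (V i) f))
  have hint' (i : Fin m) : Integrable fun x =>
      fderiv ℝ w.1 x (unitVec i) * mulTest (V i) f x := test_integrable_mul (hw i) _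
  calc ∫ x, (vectorField V w).1 x * f x
      = ∫ x, ∑ i, fderiv ℝ w.1 x (unitVec i) * mulTest (V i) f x := by
        congr 1 with x
        rw [vectorField_apply, Finset.sum_mul]
        refine Finset.sum_congr rfl fun i _ => ?_
        rw [mulTest_apply]
        ring
    _ = ∑ i, ∫ x, fderiv ℝ w.1 x (unitVec i) * mulTest (V i) f x :=
        integral_finsetSum _ fun i _ => hint' i
    _ = ∑ i, -∫ x, w.1 x * fderiv ℝ (mulTest (V i) f) x (unitVec i) := by
        refine Finset.sum_congr rfl fun i _ => ?_
        rw [integral_mul_fderiv_eq_neg_fderiv_mul_of_integrable (hint' i) (hint i)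
          (test_integrable_mul (smooth_contDiff w).continuous _)
          (fun x _ => smooth_differentiable w x) (fun x _ => test_differentiable _ x), neg_neg]
    _ = -∫ x, ∑ i, w.1 x * fderiv ℝ (mulTest (V i) f) x (unitVec i) := by
        rw [Finset.sum_neg_distrib, integral_finsetSum _ fun i _ => hint i]
    _ = ∫ x, w.1 x * adjointField V f x := by
        rw [← integral_neg]
        congr 1 with x
        rw [adjointField_apply, mul_neg, Finset.mul_sum]

/-! ### Integrals of dilated functions of a smooth function -/

/-- The integral `∫ φ(G(x)/ε) f(x) dx`. -/
def dilInt {m : ℕ} (φ : ℝ → ℝ) (ε : ℝ) (G : Smooth m) (f : Test m) : ℝ :=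
  ∫ x, φ (ε⁻¹ * G.1 x) * f x

/-- The chain rule gives `V(φ(G/ε)) = ε⁻¹ φ'(G/ε) VG`; integration by parts then moves `V` onto `f`.
-/
theorem dilInt_vectorField {m : ℕ} {φ : ℝ → ℝ} (hφ : ContDiff ℝ ∞ φ) {ε : ℝ} (hε : ε ≠ 0)
    (V : Fin m → Smooth m) (G : Smooth m) (f : Test m) :
    dilInt (deriv φ) ε G (mulTest (vectorField V G) f) = ε * dilInt φ ε G (adjointField V f) := by
  have hc : ContDiff ℝ ∞ fun x => φ (ε⁻¹ * G.1 x) :=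
    hφ.comp (contDiff_const.mul (smooth_contDiff G))
  have := integral_vectorField_mul V ⟨_, hc⟩ f
  rw [dilInt, dilInt, ← this, ← integral_const_mul]
  congr 1 with x
  rw [vectorField_apply, mulTest_apply, vectorField_apply, Finset.sum_mul, Finset.sum_mul,
    Finset.mul_sum, Finset.mul_sum]
  refine Finset.sum_congr rfl fun i _ => ?_
  have hd : fderiv ℝ (fun x => φ (ε⁻¹ * G.1 x)) x (unitVec i) =
      deriv φ (ε⁻¹ * G.1 x) * (ε⁻¹ * fderiv ℝ G.1 x (unitVec i)) := by
    have h1 : HasFDerivAt (fun x => ε⁻¹ * G.1 x) (ε⁻¹ • fderiv ℝ G.1 x) x :=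
      (smooth_differentiable G x).hasFDerivAt.const_mul ε⁻¹
    have h2 : HasDerivAt φ (deriv φ (ε⁻¹ * G.1 x)) (ε⁻¹ * G.1 x) :=
      (hφ.differentiable (by simp) _).hasDerivAt
    have h3 := h2.comp_hasFDerivAt x h1
    change fderiv ℝ (φ ∘ fun x => ε⁻¹ * G.1 x) x (unitVec i) = _
    rw [h3.fderiv]
    rfl
  change _ = ε * ((V i).1 x * fderiv ℝ (fun x => φ (ε⁻¹ * G.1 x)) x (unitVec i) * f x)
  rw [hd]
  field_simp

theorem dilInt_integrable {m : ℕ} {φ : ℝ → ℝ} (hφ : Continuous φ) (ε : ℝ) (G : Smooth m)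
    (f : Test m) : Integrable fun x => φ (ε⁻¹ * G.1 x) * f x :=
  test_integrable_mul (hφ.comp (continuous_const.mul (smooth_contDiff G).continuous)) f

theorem dilInt_sub {m : ℕ} {φ : ℝ → ℝ} (hφ : Continuous φ) (ε : ℝ) (G : Smooth m)
    (f k : Test m) : dilInt φ ε G (f - k) = dilInt φ ε G f - dilInt φ ε G k := by
  rw [dilInt, dilInt, dilInt,
    ← integral_sub (dilInt_integrable hφ ε G f) (dilInt_integrable hφ ε G k)]
  congr 1 with x
  exact mul_sub _ (f x) (k x)

theorem exists_radius_of_hasCompactSupport {φ : ℝ → ℝ} (hφ : HasCompactSupport φ) :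
    ∃ R : ℝ, 0 < R ∧ ∀ t, R ≤ |t| → φ t = 0 := by
  obtain ⟨R, hR⟩ := hφ.isCompact.isBounded.exists_norm_le
  refine ⟨max R 0 + 1, by positivity, fun t ht => image_eq_zero_of_notMem_tsupport fun h => ?_⟩
  have := hR t h
  rw [Real.norm_eq_abs] at this
  linarith [le_max_left R 0]

/-- On the compact support of `f`, `|G|` is bounded below, so `G/ε` leaves the support of `φ` once
`ε` is small. -/
theorem dilInt_eventually_eq_zero {m : ℕ} {φ : ℝ → ℝ} (hφ : HasCompactSupport φ) {G : Smooth m}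
    {f : Test m} (hf : ∀ x ∈ tsupport f, G.1 x ≠ 0) :
    ∀ᶠ ε in 𝓝[>] (0 : ℝ), dilInt φ ε G f = 0 := by
  obtain ⟨R, hR0, hR⟩ := exists_radius_of_hasCompactSupport hφ
  obtain ⟨c, hc, hG⟩ : ∃ c : ℝ, 0 < c ∧ ∀ x ∈ tsupport f, c ≤ |G.1 x| := by
    rcases (tsupport f).eq_empty_or_nonempty with h | h
    · exact ⟨1, one_pos, by simp [h]⟩
    · obtain ⟨x, hx, hmin⟩ := f.hasCompactSupport.isCompact.exists_isMinOn h
        (smooth_contDiff G).continuous.abs.continuousOn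
      exact ⟨|G.1 x|, abs_pos.2 (hf x hx), fun y hy => hmin hy⟩
  filter_upwards [Ioo_mem_nhdsGT (show (0 : ℝ) < c / R by positivity)] with ε hε
  have hε0 : 0 < ε := hε.1
  rw [dilInt, ← integral_zero (Bos m) ℝ]
  congr 1 with x
  by_cases hx : x ∈ tsupport f
  · rw [hR, zero_mul]
    rw [abs_mul, abs_inv, abs_of_pos hε0, ← div_eq_inv_mul, le_div_iff₀ hε0]
    have := (lt_div_iff₀ hR0).1 hε.2
    linarith [hG x hx]
  · rw [image_eq_zero_of_notMem_tsupport hx, mul_zero]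

/-! ### Vector fields transversal to a hypersurface -/

/-- The vector field `V` satisfies `V G = 1` near the zero set of `G`. -/
def Transversal {m : ℕ} (V : Fin m → Smooth m) (G : Smooth m) : Prop :=
  ∀ x, G.1 x = 0 → ∀ᶠ y in 𝓝 x, (vectorField V G).1 y = 1

theorem exists_transversal {m : ℕ} {G : Smooth m}
    (hG : ∀ x, G.1 x = 0 → ∃ i, (partialD i G).1 x ≠ 0) : ∃ V, Transversal V G := by
  set N : Smooth m := ∑ i, partialD i G * partialD i G with hN
  have hNx (x : Bos m) : N.1 x = ∑ i, (partialD i G).1 x * (partialD i G).1 x := by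
    rw [hN, smooth_sum_apply]
    rfl
  have hN0 (x : Bos m) : 0 ≤ N.1 x := by
    rw [hNx]
    exact Finset.sum_nonneg fun i _ => mul_self_nonneg _
  have hNpos (x : Bos m) (hx : G.1 x = 0) : 0 < N.1 x := by
    obtain ⟨i, hi⟩ := hG x hx
    rw [hNx]
    exact Finset.sum_pos' (fun i _ => mul_self_nonneg _) ⟨i, Finset.mem_univ i, mul_self_pos.2 hi⟩
  -- The field is the gradient divided by a positive modification `M` of `N = |∇G|²`. The added term
  -- vanishes where `G² ≤ N`, hence near the zero set; where `N = 0` it is positive because `G ≠ 0`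
  -- there.
  set M : Bos m → ℝ := fun x => N.1 x + expNegInvGlue (G.1 x ^ 2 - N.1 x) with hM
  have hMc : ContDiff ℝ ∞ M := (smooth_contDiff N).add
    (expNegInvGlue.contDiff.comp (((smooth_contDiff G).pow 2).sub (smooth_contDiff N)))
  have hMpos (x : Bos m) : 0 < M x := by
    rcases (hN0 x).eq_or_lt with h | h
    · have : G.1 x ≠ 0 := fun h0 => (hNpos x h0).ne h
      have h1 : 0 < G.1 x ^ 2 - N.1 x := by rw [← h, sub_zero]; positivity
      exact add_pos_of_nonneg_of_pos (hN0 x) (expNegInvGlue.pos_of_pos h1)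
    · exact add_pos_of_pos_of_nonneg h (expNegInvGlue.nonneg _)
  set I : Smooth m := ⟨fun x => (M x)⁻¹, hMc.inv fun x => (hMpos x).ne'⟩
  refine ⟨fun i => I * partialD i G, fun x hx => ?_⟩
  have hV (y : Bos m) : (vectorField (fun i => I * partialD i G) G).1 y = (M y)⁻¹ * N.1 y := by
    rw [vectorField_apply, hNx, Finset.mul_sum]
    refine Finset.sum_congr rfl fun i _ => ?_
    change (M y)⁻¹ * (partialD i G).1 y * (partialD i G).1 y = _
    ring
  have hcont : Continuous fun y => G.1 y ^ 2 - N.1 y :=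
    ((smooth_contDiff G).continuous.pow 2).sub (smooth_contDiff N).continuous
  have : ∀ᶠ y in 𝓝 x, G.1 y ^ 2 - N.1 y < 0 := by
    refine hcont.continuousAt.eventually_lt continuousAt_const ?_
    rw [hx]
    linarith [hNpos x hx]
  filter_upwards [this] with y hy
  have hMy : M y = N.1 y := by
    rw [hM]
    simp only [expNegInvGlue.zero_of_nonpos hy.le, add_zero]
  rw [hV, hMy, inv_mul_cancel₀]
  rw [← hMy]
  exact (hMpos y).ne'

theorem Transversal.ne_zero_of_mem_tsupport {m : ℕ} {V : Fin m → Smooth m} {G : Smooth m}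
    (hV : Transversal V G) (f : Test m) :
    ∀ x ∈ tsupport (f - mulTest (vectorField V G) f : Test m), G.1 x ≠ 0 := by
  intro x hx h0
  refine notMem_tsupport_iff_eventuallyEq.2 ?_ hx
  filter_upwards [hV x h0] with y hy'
  change f y - mulTest (vectorField V G) f y = 0
  rw [mulTest_apply, hy', one_mul, sub_self]

theorem Transversal.dilInt_deriv {m : ℕ} {V : Fin m → Smooth m} {G : Smooth m}
    (hV : Transversal V G) {φ : ℝ → ℝ} (hφ : ContDiff ℝ ∞ φ) (hφ' : HasCompactSupport (deriv φ))
    (f : Test m) :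
    ∀ᶠ ε in 𝓝[>] (0 : ℝ), dilInt (deriv φ) ε G f = ε * dilInt φ ε G (adjointField V f) := by
  filter_upwards [dilInt_eventually_eq_zero hφ' (hV.ne_zero_of_mem_tsupport f),
    self_mem_nhdsWithin] with ε h0 hε
  rw [dilInt_sub (hφ.continuous_deriv (by simp)), sub_eq_zero] at h0
  rw [h0, dilInt_vectorField hφ (ne_of_gt hε)]

/-! ### The Heaviside distribution of a smooth function -/

theorem exists_antideriv {φ : ℝ → ℝ} (hφ : ContDiff ℝ ∞ φ) (hc : HasCompactSupport φ) :
    ∃ (Φ : ℝ → ℝ) (R : ℝ), ContDiff ℝ ∞ Φ ∧ deriv Φ = φ ∧ 0 < R ∧ (∀ t ≤ -R, Φ t = 0) ∧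
      ∀ t, R ≤ t → Φ t = ∫ s, φ s := by
  obtain ⟨R, hR0, hR⟩ := exists_radius_of_hasCompactSupport hc
  have hd : deriv (fun t => ∫ s in (-R)..t, φ s) = φ :=
    funext fun t => hφ.continuous.deriv_integral φ (-R) t
  refine ⟨fun t => ∫ s in (-R)..t, φ s, R, ?_, hd, hR0, fun t ht => ?_, fun t ht => ?_⟩
  · rw [contDiff_infty_iff_deriv, hd]
    exact ⟨fun t => (hφ.continuous.integral_hasStrictDerivAt (-R) t).hasDerivAt.differentiableAt,
      hφ⟩
  · refine intervalIntegral.integral_zero_ae (Eventually.of_forall fun s hs => hR s ?_)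
    rw [Set.uIoc_of_ge ht] at hs
    rw [abs_of_nonpos (by linarith [hs.2])]
    linarith [hs.2]
  · refine intervalIntegral.integral_eq_integral_of_support_subset fun s hs => ?_
    by_contra h
    refine hs (hR s ?_)
    rcases not_and_or.1 h with h | h
    · rw [abs_of_nonpos (by linarith [not_lt.1 h])]
      linarith [not_lt.1 h]
    · exact ht.trans ((not_le.1 h).le.trans (le_abs_self s))

/-- The Heaviside distribution `f ↦ ∫_{G > 0} f`. -/
def heaviside {m : ℕ} (G : Smooth m) : Dist m :=
  (TestFunction.integralAgainstBilinCLM (ContinuousLinearMap.mul ℝ ℝ) volume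
    ({x | 0 < G.1 x}.indicator 1) : Test m →L[ℝ] ℝ)

theorem measurableSet_pos {m : ℕ} (G : Smooth m) : MeasurableSet {x | 0 < G.1 x} :=
  (isOpen_lt continuous_const (smooth_contDiff G).continuous).measurableSet

theorem heaviside_apply {m : ℕ} (G : Smooth m) (f : Test m) :
    heaviside G f = ∫ x, {x | 0 < G.1 x}.indicator (1 : Bos m → ℝ) x * f x := by
  have h : LocallyIntegrable ({x | 0 < G.1 x}.indicator (1 : Bos m → ℝ)) volume :=
    (locallyIntegrable_const (1 : ℝ)).indicator (measurableSet_pos G)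
  refine (TestFunction.integralAgainstBilinCLM_eq_integral (h.locallyIntegrableOn _)).trans ?_
  congr 1 with x
  exact mul_comm _ _

/-- The only place where the sign of `h` matters; elsewhere its nonvanishing is enough. -/
theorem heaviside_mul_of_pos {m : ℕ} {h : Smooth m} (hpos : ∀ x, 0 < h.1 x) (G : Smooth m) :
    heaviside (h * G) = heaviside G := by
  ext f
  rw [heaviside_apply, heaviside_apply]
  have : {x | 0 < (h * G).1 x} = {x | 0 < G.1 x} :=
    Set.ext fun x => mul_pos_iff_of_pos_left (hpos x)
  rw [this]

theorem tendsto_dilInt_smoothTransition {m : ℕ} (G : Smooth m) (f : Test m) :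
    Tendsto (fun ε => dilInt Real.smoothTransition ε G f) (𝓝[>] 0) (𝓝 (heaviside G f)) := by
  rw [heaviside_apply]
  refine tendsto_integral_filter_of_dominated_convergence (fun x => ‖f x‖)
    (Eventually.of_forall fun ε =>
      (dilInt_integrable Real.smoothTransition.continuous ε G f).aestronglyMeasurable)
    (Eventually.of_forall fun ε => Eventually.of_forall fun x => ?_)
    (f.continuous.integrable_of_hasCompactSupport f.hasCompactSupport).norm
    (Eventually.of_forall fun x => ?_)
  · rw [norm_mul]
    refine mul_le_of_le_one_left (norm_nonneg _) ?_
    rw [Real.norm_eq_abs, abs_of_nonneg (Real.smoothTransition.nonneg _)]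
    exact Real.smoothTransition.le_one _
  -- Since `Real.smoothTransition` vanishes at `0`, the limit is pointwise everywhere, including on
  -- the zero set of `G`.
  · refine tendsto_const_nhds.congr' ?_
    by_cases hx : 0 < G.1 x
    · filter_upwards [Ioo_mem_nhdsGT hx] with ε hε
      rw [Set.indicator_of_mem (by exact hx), Real.smoothTransition.one_of_one_le, Pi.one_apply]
      rw [← div_eq_inv_mul, le_div_iff₀ hε.1, one_mul]
      exact hε.2.le
    · filter_upwards [self_mem_nhdsWithin] with ε hε
      rw [Set.indicator_of_notMem (by exact hx), Real.smoothTransition.zero_of_nonpos]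
      exact mul_nonpos_of_nonneg_of_nonpos (inv_nonneg.2 (le_of_lt hε)) (not_lt.1 hx)

/-- An antiderivative `Φ` of `φ` is bounded, so integration by parts along `V` produces `ε` times a
bounded quantity. This avoids proving that the zero set of `G` is null. -/
theorem tendsto_dilInt_of_hasCompactSupport {m : ℕ} {V : Fin m → Smooth m} {G : Smooth m}
    (hV : Transversal V G) {φ : ℝ → ℝ} (hφ : ContDiff ℝ ∞ φ) (hc : HasCompactSupport φ)
    (f : Test m) : Tendsto (fun ε => dilInt φ ε G f) (𝓝[>] 0) (𝓝 0) := by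
  obtain ⟨Φ, R, hΦ, rfl, hR0, hl, hr⟩ := exists_antideriv hφ hc
  obtain ⟨B, hB⟩ : ∃ B, ∀ t, ‖Φ t‖ ≤ B := by
    obtain ⟨B, hB⟩ := isCompact_Icc.exists_bound_of_continuousOn
      (hΦ.continuous.continuousOn (s := Set.Icc (-R) R))
    refine ⟨B, fun t => ?_⟩
    rcases le_total t (-R) with h | h
    · rw [hl t h, norm_zero]
      exact (norm_nonneg _).trans (hB R ⟨by linarith, le_rfl⟩)
    · rcases le_total t R with h' | h'
      · exact hB t ⟨h, h'⟩
      · rw [hr t h', ← hr R le_rfl]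
        exact hB R ⟨by linarith, le_rfl⟩
  refine Tendsto.congr' ((hV.dilInt_deriv hΦ hc f).mono fun ε h => h.symm) ?_
  have hid : Tendsto (fun ε : ℝ => ε) (𝓝[>] 0) (𝓝 0) := tendsto_nhdsWithin_of_tendsto_nhds tendsto_id
  refine hid.zero_mul_isBoundedUnder_le
    (isBoundedUnder_of ⟨∫ x, B * ‖adjointField V f x‖, fun ε => ?_⟩)
  refine norm_integral_le_of_norm_le (Integrable.const_mul ?_ _) (Eventually.of_forall fun x => ?_)
  · exact ((adjointField V f).continuous.integrable_of_hasCompactSupport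
      (adjointField V f).hasCompactSupport).norm
  · rw [norm_mul]
    exact mul_le_mul_of_nonneg_right (hB _) (norm_nonneg _)

theorem tendsto_dilInt_heaviside {m : ℕ} {V : Fin m → Smooth m} {G : Smooth m}
    (hV : Transversal V G) {Φ : ℝ → ℝ} (hΦ : ContDiff ℝ ∞ Φ) {R c : ℝ}
    (hl : ∀ t ≤ -R, Φ t = 0) (hr : ∀ t, R ≤ t → Φ t = c) (f : Test m) :
    Tendsto (fun ε => dilInt Φ ε G f) (𝓝[>] 0) (𝓝 (c * heaviside G f)) := by
  -- Subtracting a fixed step of the same height leaves a compactly supported error, which does not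
  -- contribute in the limit.
  set ζ : ℝ → ℝ := fun t => Φ t - c * Real.smoothTransition t with hζ
  have hst : ContDiff ℝ ∞ Real.smoothTransition := Real.smoothTransition.contDiff
  have hζc : ContDiff ℝ ∞ ζ := hΦ.sub (contDiff_const.mul hst)
  have hζs : HasCompactSupport ζ := by
    refine HasCompactSupport.intro (isCompact_Icc (a := -max R 0) (b := max R 1)) fun t ht => ?_
    rw [hζ]
    dsimp only
    rcases not_and_or.1 ht with h | h
    · rw [hl t (by linarith [le_max_left R 0, not_le.1 h]),
        Real.smoothTransition.zero_of_nonpos (by linarith [le_max_right R 0, not_le.1 h]), mul_zero,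
        sub_zero]
    · rw [hr t (by linarith [le_max_left R 1, not_le.1 h]),
        Real.smoothTransition.one_of_one_le (by linarith [le_max_right R 1, not_le.1 h]), mul_one,
        sub_self]
  have h := (tendsto_dilInt_of_hasCompactSupport hV hζc hζs f).add
    ((tendsto_dilInt_smoothTransition G f).const_mul c)
  rw [zero_add] at h
  refine h.congr fun ε => ?_
  rw [dilInt, dilInt, dilInt, ← integral_const_mul, ← integral_add
    (dilInt_integrable hζc.continuous ε G f)
    ((dilInt_integrable hst.continuous ε G f).const_mul c)]
  congr 1 with x
  rw [hζ]
  ring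

/-! ### The distributions `δ^{(j)}(G)` -/

theorem contDiff_iteratedDeriv {η : ℝ → ℝ} (hη : ContDiff ℝ ∞ η) (j : ℕ) :
    ContDiff ℝ ∞ (iteratedDeriv j η) := by
  rw [iteratedDeriv_eq_iterate]
  exact hη.iterate_deriv j

theorem hasCompactSupport_iteratedDeriv {η : ℝ → ℝ} (hη : HasCompactSupport η) (j : ℕ) :
    HasCompactSupport (iteratedDeriv j η) := by
  induction j with
  | zero => simpa using hη
  | succ j ih => rw [iteratedDeriv_succ]; exact ih.deriv

theorem integral_iteratedDeriv_eq_dilInt {m : ℕ} {η : ℝ → ℝ} (hη : ContDiff ℝ ∞ η) (j : ℕ)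
    (ε : ℝ) (G : Smooth m) (f : Test m) :
    ∫ x, iteratedDeriv j (fun t => ε⁻¹ * η (ε⁻¹ * t)) (G.1 x) * f x =
      ε⁻¹ ^ (j + 1) * dilInt (iteratedDeriv j η) ε G f := by
  rw [dilInt, ← integral_const_mul]
  congr 1 with x
  rw [iteratedDeriv_const_mul_field,
    iteratedDeriv_comp_const_mul (hη.of_le (by exact_mod_cast le_top))]
  ring

/-- The distribution `f ↦ θ(G) (V*)^{j+1} f`. It is `δ^{(j)}(G)` if `V` is transversal to `G`. -/
def deltaAlong {m : ℕ} (V : Fin m → Smooth m) (G : Smooth m) : ℕ → Dist m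
  | 0 => (adjointField V).precompCompactConvergenceCLM ℝ (heaviside G)
  | j + 1 => (adjointField V).precompCompactConvergenceCLM ℝ (deltaAlong V G j)

/-- Each integration by parts removes one derivative from `η` and one factor `ε⁻¹`. The last one
replaces `η` by its antiderivative, a step of height `∫ η`. The mass is left arbitrary so that the
limit also applies to `t η(t)`. -/
theorem tendsto_deltaAlong {m : ℕ} {V : Fin m → Smooth m} {G : Smooth m}
    (hV : Transversal V G) {η : ℝ → ℝ} (hη : ContDiff ℝ ∞ η) (hc : HasCompactSupport η)
    (j : ℕ) (f : Test m) :
    Tendsto (fun ε => ε⁻¹ ^ (j + 1) * dilInt (iteratedDeriv j η) ε G f) (𝓝[>] 0)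
      (𝓝 ((∫ t, η t) * deltaAlong V G j f)) := by
  induction j generalizing f with
  | zero =>
    obtain ⟨Φ, R, hΦ, rfl, hR0, hl, hr⟩ := exists_antideriv hη hc
    refine (tendsto_dilInt_heaviside hV hΦ hl hr (adjointField V f)).congr' ?_
    filter_upwards [hV.dilInt_deriv hΦ hc f, self_mem_nhdsWithin] with ε h hε
    have hε' : ε ≠ 0 := ne_of_gt hε
    rw [iteratedDeriv_zero, h, zero_add, pow_one, inv_mul_cancel_left₀ hε']
  | succ j ih =>
    refine (ih (adjointField V f)).congr' ?_
    have hc' := hasCompactSupport_iteratedDeriv hc (j + 1)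
    rw [iteratedDeriv_succ] at hc'
    filter_upwards [hV.dilInt_deriv (contDiff_iteratedDeriv hη j) hc' f, self_mem_nhdsWithin]
      with ε h hε
    have hε' : ε ≠ 0 := ne_of_gt hε
    rw [iteratedDeriv_succ, h, pow_succ _ (j + 1), mul_assoc _ ε⁻¹, inv_mul_cancel_left₀ hε']

theorem isDeltaComp_deltaAlong {m : ℕ} {V : Fin m → Smooth m} {G : Smooth m}
    (hV : Transversal V G) (j : ℕ) : IsDeltaComp j G (deltaAlong V G j) := by
  intro η hη hc h1 f
  simp only [integral_iteratedDeriv_eq_dilInt hη]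
  simpa only [h1, one_mul] using tendsto_deltaAlong hV hη hc j f

/-- The gradient of `G` does not vanish on the zero set of `G`. -/
def Regular {m : ℕ} (G : Smooth m) : Prop :=
  ∀ x, G.1 x = 0 → ∃ i, (partialD i G).1 x ≠ 0

theorem regular_of_gradient_ne_zero {m : ℕ} {G : Smooth m}
    (hG : ∀ x, G.1 x = 0 → gradient G.1 x ≠ 0) : Regular G := by
  intro x hx
  by_contra! h
  refine hG x hx ?_
  have : fderiv ℝ G.1 x = 0 := by
    refine ContinuousLinearMap.coe_injective ((EuclideanSpace.basisFun (Fin m) ℝ).toBasis.ext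
      fun i => ?_)
    simpa [partialD_apply] using h i
  rw [gradient, this, map_zero]

theorem Regular.mul_of_pos {m : ℕ} {G h : Smooth m} (hG : Regular G) (hpos : ∀ x, 0 < h.1 x) :
    Regular (h * G) := by
  intro x hx
  have hx0 : G.1 x = 0 := (mul_eq_zero.1 hx).resolve_left (hpos x).ne'
  obtain ⟨i, hi⟩ := hG x hx0
  refine ⟨i, ?_⟩
  rw [Derivation.leibniz]
  change h.1 x * (partialD i G).1 x + G.1 x * (partialD i h).1 x ≠ 0
  rw [hx0, zero_mul, add_zero]
  exact mul_ne_zero (hpos x).ne' hi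

theorem Regular.isDeltaComp {m : ℕ} {G : Smooth m} (hG : Regular G) (j : ℕ) :
    IsDeltaComp j G (deltaComp j G) := by
  obtain ⟨V, hV⟩ := exists_transversal hG
  have h : ∃ T, IsDeltaComp j G T := ⟨_, isDeltaComp_deltaAlong hV j⟩
  rw [deltaComp, dif_pos h]
  exact h.choose_spec

theorem Transversal.deltaComp_eq {m : ℕ} {V : Fin m → Smooth m} {G : Smooth m}
    (hV : Transversal V G) (j : ℕ) : deltaComp j G = deltaAlong V G j := by
  have h : ∃ T, IsDeltaComp j G T := ⟨_, isDeltaComp_deltaAlong hV j⟩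
  rw [deltaComp, dif_pos h]
  exact h.choose_spec.unique (isDeltaComp_deltaAlong hV j)

theorem Regular.tendsto {m : ℕ} {G : Smooth m} (hG : Regular G) {η : ℝ → ℝ}
    (hη : ContDiff ℝ ∞ η) (hc : HasCompactSupport η) (j : ℕ) (f : Test m) :
    Tendsto (fun ε => ε⁻¹ ^ (j + 1) * dilInt (iteratedDeriv j η) ε G f) (𝓝[>] 0)
      (𝓝 ((∫ t, η t) * deltaComp j G f)) := by
  obtain ⟨V, hV⟩ := exists_transversal hG
  rw [hV.deltaComp_eq]
  exact tendsto_deltaAlong hV hη hc j f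

/-- A smooth function on `ℝ` with compact support and integral one. -/
theorem exists_mollifier :
    ∃ η : ℝ → ℝ, ContDiff ℝ ∞ η ∧ HasCompactSupport η ∧ ∫ t, η t = 1 := by
  let b : ContDiffBump (0 : ℝ) := ⟨1, 2, one_pos, one_lt_two⟩
  exact ⟨b.normed volume, b.contDiff_normed, b.hasCompactSupport_normed, b.integral_normed⟩

theorem Regular.deltaComp_eq_zero {m : ℕ} {G : Smooth m} (hG : Regular G) (j : ℕ) {f : Test m}
    (hf : ∀ x ∈ tsupport f, G.1 x ≠ 0) : deltaComp j G f = 0 := by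
  obtain ⟨η, hη, hc, h1⟩ := exists_mollifier
  have h := hG.tendsto hη hc j f
  rw [h1, one_mul] at h
  refine tendsto_nhds_unique h (tendsto_const_nhds.congr' ?_)
  filter_upwards [dilInt_eventually_eq_zero (hasCompactSupport_iteratedDeriv hc j) hf] with ε hε
  rw [hε, mul_zero]

/-- Allowing `K` to differ from `G` lets one field, transversal to `G`, serve for `δ^{(j)}(hG)` as
well. -/
theorem Regular.deltaComp_mulTest_vectorField {m : ℕ} {K : Smooth m} (hK : Regular K)
    {V : Fin m → Smooth m} {G : Smooth m} (hV : Transversal V G)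
    (hKG : ∀ x, K.1 x = 0 → G.1 x = 0) (j : ℕ) (f : Test m) :
    deltaComp j K (mulTest (vectorField V G) f) = deltaComp j K f := by
  have h := hK.deltaComp_eq_zero j (f := f - mulTest (vectorField V G) f)
    fun x hx h0 => hV.ne_zero_of_mem_tsupport f x hx (hKG x h0)
  rw [map_sub, sub_eq_zero] at h
  exact h.symm

/-- The chain rule `V δ^{(j)}(G) = (VG) δ^{(j+1)}(G)`, valid for any `V` since it holds before the
limit. -/
theorem Regular.deltaComp_adjointField {m : ℕ} {G : Smooth m} (hG : Regular G)
    (V : Fin m → Smooth m) (j : ℕ) (f : Test m) :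
    deltaComp j G (adjointField V f) = deltaComp (j + 1) G (mulTest (vectorField V G) f) := by
  obtain ⟨η, hη, hc, h1⟩ := exists_mollifier
  have h := hG.tendsto hη hc j (adjointField V f)
  have h' := hG.tendsto hη hc (j + 1) (mulTest (vectorField V G) f)
  rw [h1, one_mul] at h h'
  refine tendsto_nhds_unique h (h'.congr' ?_)
  filter_upwards [self_mem_nhdsWithin] with ε hε
  have hε' : ε ≠ 0 := ne_of_gt hε
  rw [iteratedDeriv_succ, dilInt_vectorField (contDiff_iteratedDeriv hη j) hε',
    pow_succ _ (j + 1), mul_assoc _ ε⁻¹, inv_mul_cancel_left₀ hε']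

theorem Regular.heaviside_adjointField {m : ℕ} {G : Smooth m} (hG : Regular G)
    (V : Fin m → Smooth m) (f : Test m) :
    heaviside G (adjointField V f) = deltaComp 0 G (mulTest (vectorField V G) f) := by
  obtain ⟨η, hη, hc, h1⟩ := exists_mollifier
  obtain ⟨W, hW⟩ := exists_transversal hG
  have h' := hG.tendsto hη hc 0 (mulTest (vectorField V G) f)
  obtain ⟨Φ, R, hΦ, rfl, hR0, hl, hr⟩ := exists_antideriv hη hc
  have h := tendsto_dilInt_heaviside hW hΦ hl hr (adjointField V f)
  rw [h1, one_mul] at h h'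
  refine tendsto_nhds_unique h (h'.congr' ?_)
  filter_upwards [self_mem_nhdsWithin] with ε hε
  have hε' : ε ≠ 0 := ne_of_gt hε
  rw [iteratedDeriv_zero, dilInt_vectorField hΦ hε', zero_add, pow_one,
    inv_mul_cancel_left₀ hε']

theorem iteratedDeriv_id_mul {η : ℝ → ℝ} (hη : ContDiff ℝ ∞ η) (j : ℕ) (t : ℝ) :
    iteratedDeriv (j + 1) (fun s => s * η s) t =
      t * iteratedDeriv (j + 1) η t + (j + 1) * iteratedDeriv j η t := by
  induction j generalizing t with
  | zero =>
    rw [zero_add, iteratedDeriv_one, iteratedDeriv_one, iteratedDeriv_zero,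
      deriv_fun_mul differentiableAt_fun_id (hη.differentiable (by simp) t)]
    simp
    ring
  | succ j ih =>
    have hd (k : ℕ) : DifferentiableAt ℝ (iteratedDeriv k η) t :=
      (contDiff_iteratedDeriv hη k).differentiable (by simp) t
    rw [iteratedDeriv_succ, funext ih, deriv_fun_add (differentiableAt_fun_id.fun_mul (hd _))
      ((hd _).const_mul _), deriv_fun_mul differentiableAt_fun_id (hd _),
      deriv_const_mul _ (hd _), ← iteratedDeriv_succ, ← iteratedDeriv_succ]
    simp
    ring

theorem dilInt_mulTest_self {m : ℕ} (φ : ℝ → ℝ) (ε : ℝ) (G : Smooth m) (f : Test m) :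
    ε⁻¹ * dilInt φ ε G (mulTest G f) = dilInt (fun t => t * φ t) ε G f := by
  rw [dilInt, dilInt, ← integral_const_mul]
  congr 1 with x
  rw [mulTest_apply]
  ring

theorem tendsto_self_nhdsGT_zero : Tendsto (fun ε : ℝ => ε) (𝓝[>] 0) (𝓝 0) :=
  tendsto_nhdsWithin_of_tendsto_nhds tendsto_id

theorem Regular.deltaComp_zero_mulTest_self {m : ℕ} {G : Smooth m} (hG : Regular G) (f : Test m) :
    deltaComp 0 G (mulTest G f) = 0 := by
  obtain ⟨η, hη, hc, h1⟩ := exists_mollifier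
  obtain ⟨V, hV⟩ := exists_transversal hG
  have h := hG.tendsto hη hc 0 (mulTest G f)
  rw [h1, one_mul] at h
  refine tendsto_nhds_unique h ((tendsto_dilInt_of_hasCompactSupport hV
    (φ := fun t => t * η t) (contDiff_id.mul hη) hc.mul_left f).congr' ?_)
  filter_upwards with ε
  rw [← dilInt_mulTest_self, iteratedDeriv_zero, zero_add, pow_one]

/-- Rests on `t η^{(j+1)} = (t η)^{(j+1)} - (j+1) η^{(j)}`. The first term, normalized by
`ε^{-(j+2)}`, has a limit, but multiplication by `G` supplies one more `ε` and removes it. -/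
theorem Regular.deltaComp_succ_mulTest_self {m : ℕ} {G : Smooth m} (hG : Regular G) (j : ℕ)
    (f : Test m) :
    deltaComp (j + 1) G (mulTest G f) = -((j + 1) * deltaComp j G f) := by
  obtain ⟨η, hη, hc, h1⟩ := exists_mollifier
  have hη' : ContDiff ℝ ∞ fun t => t * η t := contDiff_id.mul hη
  have h := hG.tendsto hη hc (j + 1) (mulTest G f)
  have ha := tendsto_self_nhdsGT_zero.mul
    (hG.tendsto (η := fun t => t * η t) hη' hc.mul_left (j + 1) f)
  have hb := (hG.tendsto hη hc j f).const_mul ((j : ℝ) + 1)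
  rw [h1, one_mul] at h hb
  have hab := ha.sub hb
  rw [zero_mul, zero_sub] at hab
  refine tendsto_nhds_unique h (hab.congr' ?_)
  filter_upwards [self_mem_nhdsWithin] with ε hε
  have hε' : ε ≠ 0 := ne_of_gt hε
  have key : dilInt (iteratedDeriv (j + 1) fun t => t * η t) ε G f =
      ε⁻¹ * dilInt (iteratedDeriv (j + 1) η) ε G (mulTest G f) +
        (j + 1) * dilInt (iteratedDeriv j η) ε G f := by
    rw [dilInt_mulTest_self, dilInt, dilInt, dilInt, ← integral_const_mul, ← integral_add]
    · congr 1 with x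
      rw [iteratedDeriv_id_mul hη]
      ring
    · exact dilInt_integrable (continuous_id.mul (contDiff_iteratedDeriv hη _).continuous) ε G f
    · exact (dilInt_integrable (contDiff_iteratedDeriv hη _).continuous ε G f).const_mul _
  rw [key]
  linear_combination (ε⁻¹ ^ (j + 2) * dilInt (iteratedDeriv (j + 1) η) ε G (mulTest G f) +
    (j + 1) * ε⁻¹ ^ (j + 1) * dilInt (iteratedDeriv j η) ε G f) * mul_inv_cancel₀ hε'

/-! ### The scaling rule for `δ^{(j)}` -/

theorem vectorField_pow_of_mul_eq_one {m : ℕ} {h y : Smooth m} (hy : h * y = 1)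
    (V : Fin m → Smooth m) (j : ℕ) :
    vectorField V (y ^ (j + 1)) = -((j + 1) • (y ^ (j + 2) * vectorField V h)) := by
  have h1 : vectorField V (h * y) = 0 := by rw [hy, Derivation.map_one_eq_zero]
  rw [Derivation.leibniz, smul_eq_mul, smul_eq_mul] at h1
  rw [Derivation.leibniz_pow, Nat.add_sub_cancel, smul_eq_mul, nsmul_eq_mul, nsmul_eq_mul]
  linear_combination ((j + 1 : ℕ) : Smooth m) * y ^ (j + 1) * h1 -
    ((j + 1 : ℕ) : Smooth m) * y ^ j * vectorField V y * hy

/-- Apply `V` to the identity for one order to get the next, starting from `θ(hG) = θ(G)`. Near the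
zero set `V(hG) = h + G Vh`, so the left side yields `h δ^{(j+1)}(hG)` plus a term which the
recursion lowers to order `j`. -/
theorem Regular.deltaComp_mul {m : ℕ} {G h y : Smooth m} (hG : Regular G)
    (hpos : ∀ x, 0 < h.1 x) (hy : h * y = 1) (j : ℕ) (f : Test m) :
    deltaComp j (h * G) f = deltaComp j G (mulTest (y ^ (j + 1)) f) := by
  obtain ⟨V, hV⟩ := exists_transversal hG
  have hK := hG.mul_of_pos hpos
  have hKG (x : Bos m) (hx : (h * G).1 x = 0) : G.1 x = 0 :=
    (mul_eq_zero.1 hx).resolve_left (hpos x).ne'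
  have hVK : vectorField V (h * G) = vectorField V G * h + h * G * (y * vectorField V h) := by
    rw [Derivation.leibniz, smul_eq_mul, smul_eq_mul]
    linear_combination -G * vectorField V h * hy
  have hsplit (j : ℕ) (f : Test m) : deltaComp j (h * G) (mulTest (vectorField V (h * G)) f) =
      deltaComp j (h * G) (mulTest h f) +
        deltaComp j (h * G) (mulTest (h * G) (mulTest (y * vectorField V h) f)) := by
    rw [hVK, mulTest_add_left, map_add, ← mulTest_mulTest,
      hK.deltaComp_mulTest_vectorField hV hKG, ← mulTest_mulTest (h * G)]
  have hone (f : Test m) : mulTest h (mulTest y f) = f := by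
    rw [mulTest_mulTest, hy]
    ext x
    rw [mulTest_apply]
    exact one_mul _
  induction j generalizing f with
  | zero =>
    have key (f : Test m) : deltaComp 0 (h * G) (mulTest h f) = deltaComp 0 G f := by
      have h1 := hsplit 0 f
      rw [hK.deltaComp_zero_mulTest_self, add_zero, ← hK.heaviside_adjointField,
        heaviside_mul_of_pos hpos, hG.heaviside_adjointField,
        hG.deltaComp_mulTest_vectorField hV fun _ => id] at h1
      exact h1.symm
    rw [zero_add, pow_one, ← key, hone]
  | succ j ih =>
    -- The lowered term `-(j+1) y (Vh) δ^{(j)}(hG)` equals, by induction, the term `-(j+1) y^{j+2}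
    -- (Vh) δ^{(j)}(G)` that arises from `V(y^{j+1})` on the other side, and the two cancel.
    have key (f : Test m) : deltaComp (j + 1) (h * G) (mulTest h f) =
        deltaComp (j + 1) G (mulTest (y ^ (j + 1)) f) := by
      have h1 := hsplit (j + 1) f
      have h2 := adjointField_mulTest V (y ^ (j + 1)) f
      rw [eq_sub_iff_add_eq] at h2
      rw [hK.deltaComp_succ_mulTest_self, ← hK.deltaComp_adjointField, ih, ih, ← h2, map_add,
        hG.deltaComp_adjointField, hG.deltaComp_mulTest_vectorField hV fun _ => id,
        vectorField_pow_of_mul_eq_one hy, mulTest_neg_left, mulTest_nsmul_left, map_neg, map_nsmul,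
        mulTest_mulTest, nsmul_eq_mul, ← mul_assoc, ← pow_succ] at h1
      push_cast at h1
      linarith
    rw [← hone f, key, hone, mulTest_mulTest, ← pow_succ]

end Superspace

end

/-! ### Assembly of the analytic and algebraic halves. -/

open Superspace in
theorem proposition3 (m n : ℕ) (g h : SuperFun m n)
    (hg : g ∈ evenSuperFun m n) (hh : h ∈ evenSuperFun m n)
    (hreg : ∀ x : Bos m, (body g).1 x = 0 → gradient (body g).1 x ≠ 0)
    (hpos : ∀ x : Bos m, 0 < (body h).1 x) :
    -- the distributions entering `δ(g)` and `δ(hg)` exist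
    (∀ j : ℕ, IsDeltaComp j (body g) (deltaComp j (body g))) ∧
    (∀ j : ℕ, IsDeltaComp j (body (h * g)) (deltaComp j (body (h * g)))) ∧
    -- `h` is invertible, and `δ(hg) = h⁻¹ δ(g)`
    IsUnit h ∧
    superDelta 0 (h * g) = superMul m n (Ring.inverse h) (superDelta 0 g) := by
  have hG : Regular (body g) := regular_of_gradient_ne_zero hreg
  have hbody : body (h * g) = body h * body g := map_mul body h g
  obtain ⟨y, hy⟩ : ∃ y : Smooth m, body h * y = 1 :=
    ⟨⟨fun x => ((body h).1 x)⁻¹, (smooth_contDiff (body h)).inv fun x => (hpos x).ne'⟩,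
      Subtype.ext (funext fun x => mul_inv_cancel₀ (hpos x).ne')⟩
  refine ⟨hG.isDeltaComp, fun j => ?_, isUnit_of_mem_evenSuperFun hh hy,
    superDelta_mul hg hh hy (fun j => ?_) fun j => ?_⟩
  · rw [hbody]
    exact (hG.mul_of_pos hpos).isDeltaComp j
  · ext f
    rw [mulDist_apply, hG.deltaComp_succ_mulTest_self]
    change _ = -((j + 1) • deltaComp j (body g) f)
    rw [nsmul_eq_mul]
    push_cast
    rfl
  · ext f
    rw [mulDist_apply, hbody, hG.deltaComp_mul hpos hy]
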